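/- Let $n\ge 2$ and let $\mathcal H^n=\{x\in\mathbb R^{n+1}\mid \langle x,x\rangle=-1,\ x_{n+1}>0\}$ be hyperbolic space in the hyperboloid model, where $\langle x,y\rangle=\sum_{i=1}^n x_iy_i-x_{n+1}y_{n+1}$; its isometry group is the group $\mathrm O^+(n,1)$ of the real matrices that preserve $\langle\cdot,\cdot\rangle$ and have positive last diagonal entry. Let $P=\bigcap_{i=1}^N\{x\in\mathcal H^n\mid\langle x,e_i\rangle\le 0\}$, with $\langle e_i,e_i\rangle=1$, be a Coxeter polyhedron: $P$ has non-empty interior, and any two of the bounding hyperplanes $e_i^\perp$, $e_j^\perp$ ($i\ne j$) either meet under an angle $\pi/m$ of $P$ with an integer $m\ge 2$ (that is, $\langle e_i,e_j\rangle=-\cos(\pi/m)$) or are parallel or ultraparallel (that is, $\langle e_i,e_j\rangle\le -1$). Let $\Gamma$ be the group generated by the reflections $s_i(x)=x-2\langle x,e_i\rangle e_i$, $1\le i\le N$. Assume that $\Gamma$ is * cofinite: $P$ has finite hyperbolic volume; and * quasi-arithmetic: there are a totally real number field $F\subset\mathbb R$, a quadratic form $q$ in $n+1$ variables over $F$ which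 has signature $(n,1)$ over $\mathbb R$ and for which $q^\sigma$ is positive definite for every embedding $\sigma:F\to\mathbb R$ other than the inclusion, and a real invertible matrix $S$ with $S^{-1}\mathrm O^+(n,1)S=\mathrm O^+(q)$ and $S^{-1}\Gamma S\subset \mathrm O^+(q)\cap \mathrm{GL}(n+1,F)$. Here $\mathrm O^+(q)$ is the group of the real matrices that preserve $q$ and each of the two components of $\{q<0\}$. Let $G=(g_{ij})$, $g_{ij}=\langle e_i,e_j\rangle$, be the Gram matrix, and let $K\subset\mathbb R$ be the Vinberg field of $\Gamma$, generated over $\mathbb Q$ by all the cycles $2^l g_{i_1i_2}g_{i_2i_3}\cdots g_{i_{l-1}i_l}g_{i_li_1}$ of $2G$. Let $C=s_{\pi(1)}s_{\pi(2)}\cdots s_{\pi(N)}\in\Gamma$, with any permutation $\pi$ of $\{1,\dots,N\}$, be a Coxeter transformation of $\Gamma$, and let $\chi_C(t)=a_0+a_1t+\dots+a_{n+1}t^{n+1}$ be its characteristic polynomial as an $(n+1)\times(n+1)$ matrix. Then $$K=\mathbb Q(a_0,a_1,\dots,a_{n+1}),$$ as subfields of $\mathbb R$. -/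

import Mathlib

open scoped ENNReal

noncomputable section

/-! ## The hyperboloid model -/

/-- The Lorentzian product `x₁ y₁ + ⋯ + xₙ yₙ - xₙ₊₁ yₙ₊₁` on `ℝⁿ⁺¹`. -/
def lorentz {n : ℕ} (x y : Fin (n + 1) → ℝ) : ℝ :=
  (∑ i : Fin n, x i.castSucc * y i.castSucc) - x (Fin.last n) * y (Fin.last n)

/-- The matrix `J = diag(1, …, 1, -1)` of the Lorentzian product. -/
def lorentzMatrix (n : ℕ) : Matrix (Fin (n + 1)) (Fin (n + 1)) ℝ :=
  Matrix.diagonal fun i => if i = Fin.last n then -1 else 1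

/-- Hyperbolic space `ℋⁿ`, the upper sheet of the hyperboloid. -/
def hyperbolicSpace (n : ℕ) : Set (Fin (n + 1) → ℝ) :=
  {x | lorentz x x = -1 ∧ 0 < x (Fin.last n)}

/-- The global chart `ℝⁿ → ℋⁿ`, `x ↦ (x, √(1 + |x|²))`. -/
def hyperboloidPoint {n : ℕ} (x : Fin n → ℝ) : Fin (n + 1) → ℝ :=
  Fin.snoc (α := fun _ => ℝ) x (Real.sqrt (1 + ∑ i, x i ^ 2))

/-- Hyperbolic volume of a subset of `ℋⁿ`: in the chart `hyperboloidPoint` the Riemannian volume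
element of `ℋⁿ` is `dx / √(1 + |x|²)`. -/
def hyperbolicVolume {n : ℕ} (A : Set (Fin (n + 1) → ℝ)) : ℝ≥0∞ :=
  ∫⁻ x in {x : Fin n → ℝ | hyperboloidPoint x ∈ A},
    ENNReal.ofReal (1 / Real.sqrt (1 + ∑ i, x i ^ 2))

/-- The group `O⁺(n,1) = Isom(ℋⁿ)` of positive Lorentzian matrices. -/
def lorentzGroupPlus (n : ℕ) : Set (GL (Fin (n + 1)) ℝ) :=
  {A | A.val.transpose * lorentzMatrix n * A.val = lorentzMatrix n ∧
    0 < A.val (Fin.last n) (Fin.last n)}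

/-! ## Coxeter polyhedra and their reflection groups -/

/-- The matrix of `s_e : x ↦ x - 2 ⟨x, e⟩ e`. -/
def reflectionMatrix {n : ℕ} (e : Fin (n + 1) → ℝ) : Matrix (Fin (n + 1)) (Fin (n + 1)) ℝ :=
  1 - (2 : ℝ) • Matrix.vecMulVec e (Matrix.mulVec (lorentzMatrix n) e)

theorem lorentz_eq_dotProduct {n : ℕ} (x y : Fin (n + 1) → ℝ) :
    lorentz x y = dotProduct (Matrix.mulVec (lorentzMatrix n) x) y := by
  simp [lorentz, lorentzMatrix, dotProduct, Matrix.mulVec_diagonal, Fin.sum_univ_castSucc,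
    Fin.castSucc_ne_last, sub_eq_add_neg]

theorem reflectionMatrix_mulVec {n : ℕ} (e x : Fin (n + 1) → ℝ) :
    Matrix.mulVec (reflectionMatrix e) x = x - (2 * lorentz x e) • e := by
  have h : dotProduct (Matrix.mulVec (lorentzMatrix n) e) x = lorentz x e := by
    rw [← lorentz_eq_dotProduct]; simp [lorentz, mul_comm]
  rw [reflectionMatrix, Matrix.sub_mulVec, Matrix.one_mulVec, Matrix.smul_mulVec,
    Matrix.vecMulVec_mulVec, h]
  ext i
  simp
  ring

theorem reflectionMatrix_mul_self {n : ℕ} {e : Fin (n + 1) → ℝ} (he : lorentz e e = 1) :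
    reflectionMatrix e * reflectionMatrix e = 1 := by
  have h := he
  rw [lorentz_eq_dotProduct] at h
  simp only [reflectionMatrix, sub_mul, mul_sub, one_mul, mul_one, smul_mul_assoc, mul_smul_comm,
    Matrix.vecMulVec_mul_vecMulVec, h, one_smul]
  module

/-- A Coxeter polyhedron `P = ⋂ᵢ {x ∈ ℋⁿ | ⟨x, eᵢ⟩ ≤ 0}` given by its outer unit normal vectors
`e₁, …, e_N`.

* `interior_nonempty`: the interior of `P` in `ℋⁿ` is the set of the points that satisfy all the
  strict inequalities.
* `angles`: if `|⟨eᵢ, eⱼ⟩| < 1`, the hyperplanes of `eᵢ` and `eⱼ` intersect and `P` has the angle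
  `α` with `⟨eᵢ, eⱼ⟩ = - cos α` there; this has to be `π / m` with `m ≥ 2`. If `⟨eᵢ, eⱼ⟩ = -1` the
  hyperplanes are parallel (angle zero), and if `⟨eᵢ, eⱼ⟩ < -1` they are ultraparallel. If
  `⟨eᵢ, eⱼ⟩ ≥ 1`, then one of the two half-spaces contains the other, so that one of the two
  hyperplanes does not bound `P`. Conversely, the conditions below imply that each of
  the `N` half-spaces is needed in the intersection: if `x` is an interior point, then
  `x + t eᵢ` leaves the `i`-th half-space first (and does so while it is still timelike). -/
structure CoxeterPolyhedron (n N : ℕ) where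
  /-- The outer normal vectors. -/
  normal : Fin N → Fin (n + 1) → ℝ
  unit : ∀ i, lorentz (normal i) (normal i) = 1
  interior_nonempty : ∃ x ∈ hyperbolicSpace n, ∀ i, lorentz x (normal i) < 0
  angles : ∀ i j, i ≠ j →
    (∃ m : ℕ, 2 ≤ m ∧ lorentz (normal i) (normal j) = -Real.cos (Real.pi / m)) ∨
      lorentz (normal i) (normal j) ≤ -1

namespace CoxeterPolyhedron

variable {n N : ℕ} (P : CoxeterPolyhedron n N)

/-- The underlying subset of `ℋⁿ`. -/
def carrier : Set (Fin (n + 1) → ℝ) :=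
  {x | x ∈ hyperbolicSpace n ∧ ∀ i, lorentz x (P.normal i) ≤ 0}

/-- The reflection in the `i`-th bounding hyperplane. -/
def reflection (i : Fin N) : GL (Fin (n + 1)) ℝ where
  val := reflectionMatrix (P.normal i)
  inv := reflectionMatrix (P.normal i)
  val_inv := reflectionMatrix_mul_self (P.unit i)
  inv_val := reflectionMatrix_mul_self (P.unit i)

/-- The hyperbolic Coxeter group of `P`, generated by the reflections in the hyperplanes
that bound `P`. -/
def coxeterGroup : Subgroup (GL (Fin (n + 1)) ℝ) :=
  Subgroup.closure (Set.range P.reflection)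

/-- The Coxeter group is cofinite: `P` has finite hyperbolic volume. -/
def IsCofinite : Prop := hyperbolicVolume P.carrier < ⊤

/-- The Gram matrix. -/
def gram : Matrix (Fin N) (Fin N) ℝ :=
  Matrix.of fun i j => lorentz (P.normal i) (P.normal j)

/-- The cycle `2ˡ g_{i₁ i₂} g_{i₂ i₃} ⋯ g_{i_l i₁}` of twice the Gram matrix, of length `l + 1`
in the present indexing; `k + 1` is taken cyclically in `Fin (l + 1)`. -/
def cycle {l : ℕ} (i : Fin (l + 1) → Fin N) : ℝ :=
  ∏ k, 2 * P.gram (i k) (i (k + 1))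

/-- The Vinberg field: the subfield of `ℝ` generated by all cycles of twice the Gram matrix. -/
def vinbergField : IntermediateField ℚ ℝ :=
  IntermediateField.adjoin ℚ {b | ∃ (l : ℕ) (i : Fin (l + 1) → Fin N), b = P.cycle i}

/-- The Coxeter transformation `s_{π(1)} s_{π(2)} ⋯ s_{π(N)}`: the product of all the generating
reflections, each taken once, in the order prescribed by the permutation `π`. -/
def coxeterTransformation (π : Equiv.Perm (Fin N)) : GL (Fin (n + 1)) ℝ :=
  (List.ofFn fun k => P.reflection (π k)).prod

end CoxeterPolyhedron

/-- The Coxeter field: the subfield of `ℝ` generated by the coefficients of the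
characteristic polynomial of `C`. -/
def coxeterField {n : ℕ} (C : GL (Fin (n + 1)) ℝ) : IntermediateField ℚ ℝ :=
  IntermediateField.adjoin ℚ (Set.range fun j : ℕ => (Matrix.charpoly C.val).coeff j)

/-! ## Quasi-arithmetic groups -/

/-- A real symmetric matrix has signature `(n,1)`: it is congruent to `diag(1, …, 1, -1)`. -/
def HasLorentzSignature {n : ℕ} (Q : Matrix (Fin (n + 1)) (Fin (n + 1)) ℝ) : Prop :=
  ∃ T : GL (Fin (n + 1)) ℝ, T.val.transpose * lorentzMatrix n * T.val = Q

/-- The group `O⁺(q)` of a real quadratic form `q(x) = xᵀ Q x` of signature `(n,1)`: the invertible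
matrices that preserve `q` and map each of the two components of the cone `{q < 0}` to itself
(two vectors of this cone lie in the same component if and only if their product is negative). -/
def orthogonalGroupPlus {n : ℕ} (Q : Matrix (Fin (n + 1)) (Fin (n + 1)) ℝ) :
    Set (GL (Fin (n + 1)) ℝ) :=
  {U | U.val.transpose * Q * U.val = Q ∧
    ∀ x : Fin (n + 1) → ℝ, dotProduct x (Matrix.mulVec Q x) < 0 →
      dotProduct x (Matrix.mulVec Q (Matrix.mulVec U.val x)) < 0}

/-- A subgroup `Γ` of `O⁺(n,1)` is quasi-arithmetic: there are a totally real number field `K ⊂ ℝ`,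
a quadratic form `q` over `K` (with symmetric matrix `Q`) of signature `(n,1)` such that `q^σ` is
positive definite for every embedding `σ : K → ℝ` other than the inclusion, and a real invertible
`S` with `S⁻¹ O⁺(n,1) S = O⁺(q)` and `S⁻¹ Γ S ⊆ O⁺(q) ∩ GL(n+1, K)`. The notion is used for
discrete groups; the group of a Coxeter polyhedron is always discrete. -/
def IsQuasiArithmetic {n : ℕ} (Γ : Subgroup (GL (Fin (n + 1)) ℝ)) : Prop :=
  ∃ (K : IntermediateField ℚ ℝ) (Q : Matrix (Fin (n + 1)) (Fin (n + 1)) K)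
    (S : GL (Fin (n + 1)) ℝ),
    NumberField K ∧ NumberField.IsTotallyReal K ∧
    Q.IsSymm ∧
    HasLorentzSignature (Q.map (algebraMap K ℝ)) ∧
    (∀ σ : K →+* ℝ, σ ≠ algebraMap K ℝ → (Q.map σ).PosDef) ∧
    (∀ A : GL (Fin (n + 1)) ℝ,
      A ∈ lorentzGroupPlus n ↔ S⁻¹ * A * S ∈ orthogonalGroupPlus (Q.map (algebraMap K ℝ))) ∧
    ∀ γ ∈ Γ, S⁻¹ * γ * S ∈ orthogonalGroupPlus (Q.map (algebraMap K ℝ)) ∩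
      Set.range (Matrix.GeneralLinearGroup.map (n := Fin (n + 1)) (algebraMap K ℝ))

end

/-!
The matrix `1 - sᵢ` has rank one, and the trace of a product of such matrices is the corresponding
cycle of `2G`. Hence every element of `ℚ[Γ]` has its trace in `K`, and by Newton's identities the
characteristic polynomial of every `γ ∈ Γ` has its coefficients in `K`. Since `Γ` is conjugate into
`GL(n + 1, F)`, also `K ⊆ F`. It remains to see that `F ⊆ ℚ(χ_γ)` for `γ = C`, and, as `F` is
totally real, it is enough that no embedding `σ : F → ℝ` other than the inclusion fixes the
coefficients of `χ_C`. If `σ` did, every eigenvalue of `C` would be an eigenvalue of an isometry of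
the positive definite form `q^σ`, so that `C` would have no real eigenvalue `r ≠ ±1`.

But `C` has an eigenvalue `r > 1`. Write `2G = U + Uᵀ` with `U` unipotent upper triangular with
respect to the order of the reflections in `C`. Then `χ_C(r) = 0` as soon as the pencil `r U + Uᵀ`
is singular, and its off-diagonal entries are nonpositive for `r ≥ 0`. If it were nonsingular for
all `r > 1`, then all of its members would be M-matrices, in particular `2G` would be
positive semidefinite. This contradicts finite volume: the normal vectors of a polyhedron of finite
volume span `ℝⁿ⁺¹`, so that `G` inherits the negative value of the Lorentzian form. Indeed, if
`v ≠ 0` were orthogonal to all of them, then moving an interior point of `P` along `v` would keep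
the strict inequalities and reach the light cone, but a neighbourhood of an ideal point has infinite
volume.
-/

/-! ## M-matrices -/

section MMatrix

open Filter Matrix Topology

variable {ι : Type*} [Fintype ι] {A : Matrix ι ι ℝ}

theorem two_mul_dotProduct_mulVec_mul {R : Type*} [CommRing R] {A : Matrix ι ι R} (hA : A.IsSymm)
    (x u : ι → R) : 2 * ((u * x) ⬝ᵥ (A *ᵥ (u * x))) =
      2 * ∑ i, u i ^ 2 * (x i * (A *ᵥ x) i) -
        ∑ i, ∑ j, A i j * (x i * x j) * (u i - u j) ^ 2 := by
  have hrow : ∑ i, u i ^ 2 * (x i * (A *ᵥ x) i) = ∑ i, ∑ j, A i j * (x i * x j) * u i ^ 2 := by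
    simp only [mulVec, dotProduct, Finset.mul_sum]
    exact Finset.sum_congr rfl fun i _ => Finset.sum_congr rfl fun j _ => by ring
  have hcol : ∑ i, u i ^ 2 * (x i * (A *ᵥ x) i) = ∑ i, ∑ j, A i j * (x i * x j) * u j ^ 2 := by
    rw [hrow, Finset.sum_comm]
    exact Finset.sum_congr rfl fun i _ => Finset.sum_congr rfl fun j _ => by
      rw [hA.apply, mul_comm (x j)]
  calc 2 * ((u * x) ⬝ᵥ (A *ᵥ (u * x)))
      = ∑ i, ∑ j, 2 * (u i * x i * (A i j * (u j * x j))) := by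
        simp only [mulVec, dotProduct, Finset.mul_sum, Pi.mul_apply]
    _ = ∑ i, ∑ j, (A i j * (x i * x j) * u i ^ 2 + A i j * (x i * x j) * u j ^ 2 -
          A i j * (x i * x j) * (u i - u j) ^ 2) :=
        Finset.sum_congr rfl fun i _ => Finset.sum_congr rfl fun j _ => by ring
    _ = _ := by
        simp only [Finset.sum_sub_distrib, Finset.sum_add_distrib, ← hrow, ← hcol, two_mul]

/-- A nonsingular M-matrix: the off-diagonal entries are nonpositive, and some positive vector
has a positive image. Among the many equivalent characterizations, this one is visibly open. -/
structure IsMMatrix (A : Matrix ι ι ℝ) : Prop where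
  offDiag_nonpos : ∀ i j, i ≠ j → A i j ≤ 0
  exists_pos : ∃ x : ι → ℝ, (∀ i, 0 < x i) ∧ ∀ i, 0 < (A *ᵥ x) i

namespace IsMMatrix

theorem one [DecidableEq ι] : IsMMatrix (1 : Matrix ι ι ℝ) :=
  ⟨fun i j h => by simp [h], 1, by simp, by simp⟩

theorem add_smul_one [DecidableEq ι] (hA : IsMMatrix A) {μ : ℝ} (hμ : 0 ≤ μ) :
    IsMMatrix (A + μ • (1 : Matrix ι ι ℝ)) := by
  obtain ⟨x, hx, hAx⟩ := hA.exists_pos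
  refine ⟨fun i j hij => by simpa [hij] using hA.offDiag_nonpos i j hij, x, hx, fun i => ?_⟩
  simpa [add_mulVec, smul_mulVec] using
    add_pos_of_pos_of_nonneg (hAx i) (mul_nonneg hμ (hx i).le)

theorem of_nonneg (hoff : ∀ i j, i ≠ j → A i j ≤ 0) {x : ι → ℝ} (hx : ∀ i, 0 ≤ x i)
    (hAx : ∀ i, 0 < (A *ᵥ x) i) : IsMMatrix A := by
  have hsmall : ∀ᶠ ε : ℝ in 𝓝[>] 0, ∀ i, 0 < (A *ᵥ (x + ε • 1)) i := by
    refine eventually_all.2 fun i => nhdsWithin_le_nhds ?_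
    have hcont : Continuous fun ε : ℝ => (A *ᵥ (x + ε • 1)) i := by
      simp only [mulVec_add, mulVec_smul]
      fun_prop
    exact hcont.continuousAt.eventually (lt_mem_nhds (by simpa using hAx i))
  obtain ⟨ε, hAε, hε⟩ := (hsmall.and self_mem_nhdsWithin).exists
  exact ⟨hoff, x + ε • 1, fun i => by simpa using add_pos_of_nonneg_of_pos (hx i) hε, hAε⟩

theorem nonneg_of_mulVec_nonneg (hA : IsMMatrix A) {y : ι → ℝ} (hy : ∀ i, 0 ≤ (A *ᵥ y) i) (i : ι) :
    0 ≤ y i := by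
  obtain ⟨x, hx, hAx⟩ := hA.exists_pos
  have : Nonempty ι := ⟨i⟩
  obtain ⟨k, hk⟩ := Finite.exists_min fun i => y i / x i
  by_contra! hi
  -- If `-t < 0` is the least ratio `y i / x i`, attained at `k`, then `z = y + t x` is nonnegative
  -- and vanishes at `k`, so that `(A z) k ≤ 0`, whereas `(A y) k ≥ 0` and `t (A x) k > 0`.
  obtain ⟨t, ht⟩ : ∃ t, y k / x k = -t := ⟨_, (neg_neg _).symm⟩
  have ht0 : 0 < t := by
    rw [← neg_neg_iff_pos, ← ht]
    exact (hk i).trans_lt (div_neg_of_neg_of_pos hi (hx i))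
  have hz : ∀ j, 0 ≤ (y + t • x) j := fun j => by
    have := (le_div_iff₀ (hx j)).1 (hk j)
    rw [ht] at this
    simpa using (by linarith : 0 ≤ y j + t * x j)
  have hzk : (y + t • x) k = 0 := by
    simpa using (by linarith [(div_eq_iff (hx k).ne').1 ht] : y k + t * x k = 0)
  have hAz : (A *ᵥ (y + t • x)) k ≤ 0 := by
    refine Finset.sum_nonpos fun j _ => ?_
    rcases eq_or_ne k j with rfl | hj
    · rw [hzk, mul_zero]
    · exact mul_nonpos_of_nonpos_of_nonneg (hA.offDiag_nonpos k j hj) (hz j)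
  rw [mulVec_add, mulVec_smul] at hAz
  exact hAz.not_gt (add_pos_of_nonneg_of_pos (hy k) (mul_pos ht0 (hAx k)))

theorem det_ne_zero [DecidableEq ι] (hA : IsMMatrix A) : A.det ≠ 0 := by
  intro h
  obtain ⟨v, hv, hAv⟩ := exists_mulVec_eq_zero_iff.2 h
  exact hv <| funext fun i => le_antisymm
    (neg_nonneg.1 (hA.nonneg_of_mulVec_nonneg (y := -v) (by simp [mulVec_neg, hAv]) i))
    (hA.nonneg_of_mulVec_nonneg (by simp [hAv]) i)

theorem of_mem_closure [DecidableEq ι] (hA : A ∈ closure {B : Matrix ι ι ℝ | IsMMatrix B})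
    (hdet : A.det ≠ 0) : IsMMatrix A := by
  have hfreq : ∃ᶠ B in 𝓝 A, IsMMatrix B := mem_closure_iff_frequently.1 hA
  have hoff : ∀ i j, i ≠ j → A i j ≤ 0 := fun i j hij =>
    isClosed_Iic.mem_of_frequently_of_tendsto (hfreq.mono fun B hB => hB.offDiag_nonpos i j hij)
      (continuous_id.matrix_elem i j).continuousAt
  have hinv : ∀ i, 0 ≤ (A⁻¹ *ᵥ 1) i := fun i => by
    have hcont : ContinuousAt (fun B : Matrix ι ι ℝ => (B⁻¹ *ᵥ 1) i) A := by
      refine ((continuous_apply i).comp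
        (continuous_id.matrix_mulVec continuous_const)).continuousAt.comp
        (continuousAt_matrix_inv A ?_)
      simpa only [Ring.inverse_eq_inv'] using continuousAt_inv₀ hdet
    refine isClosed_Ici.mem_of_frequently_of_tendsto (hfreq.mono fun B hB => ?_) hcont
    refine hB.nonneg_of_mulVec_nonneg (fun j => ?_) i
    rw [mulVec_mulVec, mul_nonsing_inv _ hB.det_ne_zero.isUnit, one_mulVec]
    exact zero_le_one
  refine of_nonneg hoff hinv fun i => ?_
  rw [mulVec_mulVec, mul_nonsing_inv _ hdet.isUnit, one_mulVec]
  exact zero_lt_one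

theorem of_path [DecidableEq ι] {X : Type*} [TopologicalSpace X] [PreconnectedSpace X]
    {f : X → Matrix ι ι ℝ} (hf : Continuous f) (hoff : ∀ t i j, i ≠ j → f t i j ≤ 0)
    (hdet : ∀ t, (f t).det ≠ 0) {t₀ : X} (h₀ : IsMMatrix (f t₀)) (t : X) : IsMMatrix (f t) := by
  have hclosed : IsClosed {t | IsMMatrix (f t)} :=
    isClosed_of_closure_subset fun t ht => of_mem_closure
      (closure_mono (Set.image_subset_iff.2 fun _ h => h)
        (image_closure_subset_closure_image hf ⟨t, ht, rfl⟩)) (hdet t)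
  have hopen : IsOpen {t | IsMMatrix (f t)} := by
    refine isOpen_iff_eventually.2 fun t ht => ?_
    obtain ⟨x, hx, hAx⟩ := ht.exists_pos
    have hev : ∀ᶠ s in 𝓝 t, ∀ i, 0 < (f s *ᵥ x) i := eventually_all.2 fun i =>
      ((continuous_apply i).comp (hf.matrix_mulVec continuous_const)).continuousAt.eventually
        (lt_mem_nhds (hAx i))
    exact hev.mono fun s hs => ⟨hoff s, x, hx, hs⟩
  exact (IsClopen.eq_univ ⟨hclosed, hopen⟩ ⟨t₀, h₀⟩).ge (Set.mem_univ t)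

theorem of_isUpperTriangular [LinearOrder ι] {U : Matrix ι ι ℝ} (hU : U.IsUpperTriangular)
    (hdiag : ∀ i, 0 < U i i) (hoff : ∀ i j, i ≠ j → U i j ≤ 0) : IsMMatrix U := by
  have hpath := of_path (X := Set.Icc (0 : ℝ) 1)
    (f := fun t => (1 - (t : ℝ)) • (1 : Matrix ι ι ℝ) + (t : ℝ) • U) (by fun_prop)
    (fun t i j hij => by simpa [hij] using mul_nonpos_of_nonneg_of_nonpos t.2.1 (hoff i j hij))
    (fun t => by
      rw [det_of_isUpperTriangular fun i j hij => by simp [(show j < i from hij).ne', hU hij]]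
      refine Finset.prod_ne_zero_iff.2 fun i _ => ne_of_gt ?_
      simpa using convex_Ioi (0 : ℝ) (Set.mem_Ioi.2 one_pos) (hdiag i) (sub_nonneg.2 t.2.2) t.2.1
        (sub_add_cancel 1 _))
    (t₀ := ⟨0, by simp⟩) (by simpa using one) ⟨1, by simp⟩
  simpa using hpath

theorem posSemidef (hA : IsMMatrix A) (hs : A.IsSymm) : A.PosSemidef := by
  obtain ⟨x, hx, hAx⟩ := hA.exists_pos
  refine .of_dotProduct_mulVec_nonneg hs fun y => ?_
  have hy : y / x * x = y := funext fun i => div_mul_cancel₀ _ (hx i).ne'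
  have hform := two_mul_dotProduct_mulVec_mul hs x (y / x)
  have hdiag : 0 ≤ ∑ i, (y / x) i ^ 2 * (x i * (A *ᵥ x) i) :=
    Finset.sum_nonneg fun i _ => mul_nonneg (sq_nonneg _) (mul_pos (hx i) (hAx i)).le
  have hoff : ∑ i, ∑ j, A i j * (x i * x j) * ((y / x) i - (y / x) j) ^ 2 ≤ 0 := by
    refine Finset.sum_nonpos fun i _ => Finset.sum_nonpos fun j _ => ?_
    rcases eq_or_ne i j with rfl | hij
    · simp
    · exact mul_nonpos_of_nonpos_of_nonneg (mul_nonpos_of_nonpos_of_nonneg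
        (hA.offDiag_nonpos i j hij) (mul_pos (hx i) (hx j)).le) (sq_nonneg _)
  rw [hy] at hform
  simp only [star_trivial]
  linarith

theorem posSemidef_of_mem_closure (hA : A ∈ closure {B : Matrix ι ι ℝ | IsMMatrix B})
    (hs : A.IsSymm) : A.PosSemidef := by
  classical
  have hdet : ∀ᶠ μ : ℝ in 𝓝[>] 0, (A + μ • (1 : Matrix ι ι ℝ)).det ≠ 0 := by
    have hfin := Polynomial.finite_setOfPred_isRoot (charpoly_monic (-A)).ne_zero
    filter_upwards [nhdsGT_le_nhdsNE _ (nhdsNE_le_cofinite _ hfin.eventually_cofinite_notMem)]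
      with μ hμ h
    refine hμ ?_
    rw [Polynomial.IsRoot, eval_charpoly, sub_neg_eq_add, ← h, add_comm,
      smul_one_eq_diagonal, scalar_apply]
  have hpsd : ∀ᶠ μ : ℝ in 𝓝[>] 0, (A + μ • (1 : Matrix ι ι ℝ)).PosSemidef := by
    filter_upwards [hdet, self_mem_nhdsWithin] with μ hμ hμ0
    have hmem := closure_mono (Set.image_subset_iff.2 fun _ hB => hB.add_smul_one (le_of_lt hμ0))
      (image_closure_subset_closure_image (continuous_add_const (μ • (1 : Matrix ι ι ℝ)))
        ⟨A, hA, rfl⟩)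
    exact (of_mem_closure hmem hμ).posSemidef (by simp [IsSymm, hs.eq])
  refine .of_dotProduct_mulVec_nonneg hs fun y => ?_
  have hcont : Continuous fun μ : ℝ => star y ⬝ᵥ ((A + μ • (1 : Matrix ι ι ℝ)) *ᵥ y) := by
    simp only [add_mulVec, smul_mulVec, one_mulVec, dotProduct_add, dotProduct_smul, smul_eq_mul]
    fun_prop
  simpa using isClosed_Ici.mem_of_tendsto (hcont.tendsto' 0 _ rfl |>.mono_left nhdsWithin_le_nhds)
    (hpsd.mono fun μ hμ => hμ.dotProduct_mulVec_nonneg y)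

end IsMMatrix

theorem exists_one_lt_det_smul_add_transpose_eq_zero [DecidableEq ι] {U : Matrix ι ι ℝ}
    (hU : IsMMatrix U) (hnpsd : ¬(U + Uᵀ).PosSemidef) :
    ∃ r : ℝ, 1 < r ∧ (r • U + Uᵀ).det = 0 := by
  contrapose! hnpsd with hdet
  have hpath : ∀ ε ∈ Set.Ico (0 : ℝ) 1, IsMMatrix (U + ε • Uᵀ) := fun ε hε => by
    have : PreconnectedSpace (Set.Ico (0 : ℝ) 1) := Subtype.preconnectedSpace isPreconnected_Ico
    refine IsMMatrix.of_path (X := Set.Ico (0 : ℝ) 1) (f := fun ε => U + (ε : ℝ) • Uᵀ)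
      (by fun_prop) (fun t i j hij => ?_) (fun ⟨t, ht0, ht1⟩ => ?_)
      (t₀ := ⟨0, by simp⟩) (by simpa using hU) ⟨ε, hε⟩
    · simpa using add_nonpos (hU.offDiag_nonpos i j hij)
        (mul_nonpos_of_nonneg_of_nonpos t.2.1 (hU.offDiag_nonpos j i hij.symm))
    · rcases ht0.eq_or_lt with rfl | ht0
      · simpa using hU.det_ne_zero
      · have hscale : U + t • Uᵀ = t • (t⁻¹ • U + Uᵀ) := by
          rw [smul_add, smul_inv_smul₀ ht0.ne']
        rw [hscale, det_smul]
        exact mul_ne_zero (pow_ne_zero _ ht0.ne') (hdet _ ((one_lt_inv₀ ht0).2 ht1))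
  refine IsMMatrix.posSemidef_of_mem_closure ?_ (by simp [IsSymm, add_comm])
  have hone : (1 : ℝ) ∈ closure (Set.Ico (0 : ℝ) 1) := by
    rw [closure_Ico zero_ne_one]
    simp
  have hcont : Continuous fun ε : ℝ => U + ε • Uᵀ := by fun_prop
  exact closure_mono (Set.image_subset_iff.2 hpath)
    (image_closure_subset_closure_image hcont ⟨1, hone, by simp⟩)

end MMatrix

/-! ## Characteristic polynomials of products of reflections -/

section ReflectionProduct

open Matrix

variable {R : Type*} [CommRing R]

/-- The upper unitriangular matrix with the entries of `W` above the diagonal. A symmetric `W`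
with diagonal entries `2` is the sum of it and its transpose. -/
def unitUpperPart {ι : Type*} [LinearOrder ι] (W : Matrix ι ι R) : Matrix ι ι R :=
  of fun i j => if i < j then W i j else if i = j then 1 else 0

section unitUpperPart

variable {ι : Type*} [LinearOrder ι]

theorem isUpperTriangular_unitUpperPart (W : Matrix ι ι R) :
    (unitUpperPart W).IsUpperTriangular := fun i j hij => by
  have hji : j < i := hij
  simp [unitUpperPart, hji.not_gt, hji.ne']

theorem unitUpperPart_apply_self (W : Matrix ι ι R) (i : ι) : unitUpperPart W i i = 1 := by
  simp [unitUpperPart]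

theorem det_unitUpperPart [Fintype ι] (W : Matrix ι ι R) : (unitUpperPart W).det = 1 := by
  rw [det_of_isUpperTriangular (isUpperTriangular_unitUpperPart W)]
  simp [unitUpperPart_apply_self]

theorem unitUpperPart_add_transpose {W : Matrix ι ι R} (hW : W.IsSymm) (hdiag : ∀ i, W i i = 2) :
    unitUpperPart W + (unitUpperPart W)ᵀ = W := by
  ext i j
  rcases lt_trichotomy i j with h | rfl | h
  · simp [unitUpperPart, h, h.not_gt, h.ne']
  · simp [unitUpperPart, hdiag, one_add_one_eq_two]
  · simp [unitUpperPart, h, h.not_gt, h.ne', hW.apply]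

theorem isMMatrix_unitUpperPart [Fintype ι] {W : Matrix ι ι ℝ} (hoff : ∀ i j, i ≠ j → W i j ≤ 0) :
    IsMMatrix (unitUpperPart W) := by
  refine .of_isUpperTriangular (isUpperTriangular_unitUpperPart W) (fun i => ?_) fun i j hij => ?_
  · rw [unitUpperPart_apply_self]
    exact one_pos
  · simp only [unitUpperPart, of_apply, if_neg hij]
    split_ifs
    exacts [hoff i j hij, le_rfl]

end unitUpperPart

theorem mul_of_cons {l m : Type*} {N : ℕ} (A : Matrix l (Fin (N + 1)) R) (v : m → R)
    (c : Matrix (Fin N) m R) :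
    A * of (Fin.cons (α := fun _ => m → R) v c) =
      vecMulVec (fun i => A i 0) v + A.submatrix id Fin.succ * c := by
  ext i j
  rw [mul_apply, Fin.sum_univ_succ]
  rfl

variable {m : Type*} [Fintype m] [DecidableEq m] {N : ℕ}

theorem exists_prod_one_sub_vecMulVec_eq (e f : Fin N → m → R) :
    ∃ c : Matrix (Fin N) m R, unitUpperPart (of f * (of e)ᵀ) * c = of f ∧
      (List.ofFn fun k => 1 - vecMulVec (e k) (f k)).prod = 1 - (of e)ᵀ * c := by
  induction N with
  | zero => exact ⟨0, by ext i; exact i.elim0, by simp⟩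
  | succ N ih =>
    obtain ⟨c, hc, hprod⟩ := ih (fun k => e k.succ) (fun k => f k.succ)
    set E : Matrix (Fin N) m R := of fun k => e k.succ
    set v := f 0 ᵥ* (1 - Eᵀ * c) with hv
    refine ⟨of (Fin.cons (α := fun _ => m → R) v c), ?_, ?_⟩
    · rw [mul_of_cons]
      ext i j
      refine Fin.cases ?_ (fun i => ?_) i
      · have hrow : (fun k => unitUpperPart (of f * (of e)ᵀ) 0 (Fin.succ k)) = f 0 ᵥ* Eᵀ :=
          funext fun k => by rw [unitUpperPart, of_apply, if_pos (Fin.succ_pos k)]; rfl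
        have hv0 : v + (f 0 ᵥ* Eᵀ) ᵥ* c = f 0 := by
          rw [hv, vecMul_sub, vecMul_one, vecMul_vecMul, sub_add_cancel]
        rw [← hrow] at hv0
        rw [Matrix.add_apply, vecMulVec_apply, unitUpperPart_apply_self, one_mul]
        exact congrFun hv0 j
      · have hrows : (unitUpperPart (of f * (of e)ᵀ)).submatrix Fin.succ Fin.succ =
            unitUpperPart (of (fun k => f k.succ) * Eᵀ) := by
          ext i k
          simp [unitUpperPart, mul_apply, E]
        have hci := congrFun (congrFun hc i) j
        rw [← hrows] at hci
        have hzero : unitUpperPart (of f * (of e)ᵀ) i.succ 0 = 0 := by simp [unitUpperPart]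
        rw [Matrix.add_apply, vecMulVec_apply, hzero, zero_mul, zero_add]
        exact hci
    · rw [List.ofFn_succ, List.prod_cons, hprod, mul_of_cons, sub_mul, one_mul, vecMulVec_mul,
        sub_sub, add_comm]
      rfl

theorem eval_charpoly_prod_one_sub_vecMulVec {e f : Fin N → m → R} {W : Matrix (Fin N) (Fin N) R}
    (hW : of f * (of e)ᵀ = W) (hs : W.IsSymm) (hdiag : ∀ i, W i i = 2) (r : R) :
    (r - 1) ^ N * (List.ofFn fun k => 1 - vecMulVec (e k) (f k)).prod.charpoly.eval r =
      (r - 1) ^ Fintype.card m * (r • unitUpperPart W + (unitUpperPart W)ᵀ).det := by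
  obtain ⟨c, hc, hprod⟩ := exists_prod_one_sub_vecMulVec_eq e f
  rw [hW] at hc
  have hleft : (1 - (of e)ᵀ * c).charpoly.eval r = (-(of e)ᵀ * c).charpoly.eval (r - 1) := by
    simp only [eval_charpoly, map_sub, map_one, Matrix.neg_mul]
    congr 1
    abel
  have hpencil : unitUpperPart W * (scalar _ (r - 1) - c * -(of e)ᵀ) =
      r • unitUpperPart W + (unitUpperPart W)ᵀ := by
    rw [Matrix.mul_sub, Matrix.mul_neg, Matrix.mul_neg, ← Matrix.mul_assoc, hc, hW,
      ← scalar_comm _ (Commute.all _), scalar_apply, ← smul_eq_diagonal_mul, sub_smul, one_smul,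
      eq_sub_of_add_eq' (unitUpperPart_add_transpose hs hdiag)]
    abel
  have hright : (r • unitUpperPart W + (unitUpperPart W)ᵀ).det =
      (c * -(of e)ᵀ).charpoly.eval (r - 1) := by
    rw [eval_charpoly, ← hpencil, det_mul, det_unitUpperPart, one_mul]
  rw [hprod, hleft, hright]
  simpa using congrArg (Polynomial.eval (r - 1)) (charpoly_mul_comm' (-(of e)ᵀ) c)

theorem exists_one_lt_isRoot_charpoly_prod_one_sub_vecMulVec {e f : Fin N → m → ℝ}
    {W : Matrix (Fin N) (Fin N) ℝ} (hW : of f * (of e)ᵀ = W) (hs : W.IsSymm)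
    (hdiag : ∀ i, W i i = 2) (hoff : ∀ i j, i ≠ j → W i j ≤ 0) (hnpsd : ¬W.PosSemidef) :
    ∃ r : ℝ, 1 < r ∧ (List.ofFn fun k => 1 - vecMulVec (e k) (f k)).prod.charpoly.IsRoot r := by
  obtain ⟨r, hr, hdet⟩ := exists_one_lt_det_smul_add_transpose_eq_zero
    (isMMatrix_unitUpperPart hoff) (by rwa [unitUpperPart_add_transpose hs hdiag])
  have heval := eval_charpoly_prod_one_sub_vecMulVec hW hs hdiag r
  rw [hdet, mul_zero] at heval
  exact ⟨r, hr, (mul_eq_zero.1 heval).resolve_left (pow_ne_zero _ (sub_pos.2 hr).ne')⟩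

end ReflectionProduct

/-! ## Gram matrices and Coxeter transformations -/

section CoxeterTransformation

open Matrix

variable {n N : ℕ}

theorem lorentz_comm (x y : Fin (n + 1) → ℝ) : lorentz x y = lorentz y x := by
  simp [lorentz, mul_comm]

theorem reflectionMatrix_eq (e : Fin (n + 1) → ℝ) :
    reflectionMatrix e = 1 - vecMulVec e ((2 : ℝ) • lorentzMatrix n *ᵥ e) := by
  rw [reflectionMatrix, vecMulVec_smul]

namespace CoxeterPolyhedron

variable (P : CoxeterPolyhedron n N)

theorem gram_isSymm : P.gram.IsSymm := IsSymm.ext fun _ _ => lorentz_comm _ _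

theorem gram_apply_nonpos {i j : Fin N} (hij : i ≠ j) : P.gram i j ≤ 0 := by
  rcases P.angles i j hij with ⟨m, hm, hcos⟩ | hle
  · have hm' : (2 : ℝ) ≤ m := by exact_mod_cast hm
    have hangle : Real.pi / m ≤ Real.pi / 2 :=
      div_le_div_of_nonneg_left Real.pi_pos.le two_pos hm'
    refine hcos.le.trans (neg_nonpos.2 (Real.cos_nonneg_of_mem_Icc ⟨?_, hangle⟩))
    linarith [Real.pi_pos, show 0 ≤ Real.pi / m by positivity]
  · exact hle.trans (by norm_num)

variable (π : Equiv.Perm (Fin N))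

theorem val_coxeterTransformation : (P.coxeterTransformation π).val =
    (List.ofFn fun k => reflectionMatrix (P.normal (π k))).prod := by
  rw [coxeterTransformation, ← Units.coeHom_apply, map_list_prod, List.map_ofFn]
  rfl

theorem coxeterTransformation_mem : P.coxeterTransformation π ∈ P.coxeterGroup := by
  refine Subgroup.list_prod_mem _ fun g hg => ?_
  obtain ⟨k, rfl⟩ := (List.mem_ofFn' _ _).1 hg
  exact Subgroup.subset_closure ⟨_, rfl⟩

theorem exists_one_lt_isRoot_charpoly_coxeterTransformation (hG : ¬P.gram.PosSemidef) :
    ∃ r : ℝ, 1 < r ∧ (P.coxeterTransformation π).val.charpoly.IsRoot r := by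
  simp only [val_coxeterTransformation, reflectionMatrix_eq]
  refine exists_one_lt_isRoot_charpoly_prod_one_sub_vecMulVec
    (W := (2 : ℝ) • P.gram.submatrix π π) ?_ ((P.gram_isSymm.submatrix π).smul 2)
    (fun i => ?_) (fun i j hij => ?_) fun h => hG ?_
  · ext i j
    change ((2 : ℝ) • lorentzMatrix n *ᵥ P.normal (π i)) ⬝ᵥ P.normal (π j) = _
    rw [smul_dotProduct, ← lorentz_eq_dotProduct]
    rfl
  · simp [gram, P.unit]
  · exact mul_nonpos_of_nonneg_of_nonpos zero_le_two (P.gram_apply_nonpos (π.injective.ne hij))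
  · have hhalf := h.smul (inv_nonneg.2 (zero_le_two (α := ℝ)))
    rw [inv_smul_smul₀ two_ne_zero] at hhalf
    exact (posSemidef_submatrix_equiv π).1 hhalf

end CoxeterPolyhedron

end CoxeterTransformation

/-! ## Traces of powers and the characteristic polynomial -/

section TracePow

open Matrix Polynomial

variable {K L m : Type*} [Field K] [Field L] [Fintype m] [DecidableEq m]

theorem det_aeval_eq_prod_roots_charpoly [IsAlgClosed K] (A : Matrix m m K) (p : K[X]) :
    (aeval A p).det = (A.charpoly.roots.map p.eval).prod := by
  have hsplits := IsAlgClosed.splits A.charpoly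
  have hcard : Multiset.card A.charpoly.roots = Fintype.card m := by
    rw [← hsplits.natDegree_eq_card_roots, charpoly_natDegree_eq_dim]
  induction (IsAlgClosed.splits p) using Submonoid.closure_induction with
  | one => simp
  | mul p q _ _ hp hq => simp [det_mul, hp, hq, Multiset.prod_map_mul]
  | mem p hp =>
    rcases hp with ⟨a, rfl⟩ | ⟨a, rfl⟩
    · simp [algebraMap_eq_diagonal, hcard]
    · have hA : aeval A (X + C a) = -(scalar m (-a) - A) := by
        rw [map_neg, neg_sub, sub_neg_eq_add]
        simp [algebraMap_eq_diagonal, Pi.algebraMap_def]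
      rw [hA, det_neg, ← eval_charpoly, hsplits.eval_eq_prod_roots_of_monic A.charpoly_monic,
        ← hcard, ← Multiset.prod_replicate, ← Multiset.map_const', ← Multiset.prod_map_mul]
      simp [add_comm]

theorem trace_pow_eq_sum_roots_charpoly [IsAlgClosed K] (A : Matrix m m K) (k : ℕ) :
    (A ^ k).trace = (A.charpoly.roots.map (· ^ k)).sum := by
  have hchar : (A ^ k).charpoly =
      ((A.charpoly.roots.map (· ^ k)).map fun μ => X - C μ).prod := by
    have := IsAlgClosed.instInfinite (K := K)
    refine Polynomial.funext fun x => ?_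
    have := det_aeval_eq_prod_roots_charpoly A (C x - X ^ k)
    rw [eval_charpoly, eval_multiset_prod, Multiset.map_map, Multiset.map_map]
    simpa [algebraMap_eq_diagonal, Pi.algebraMap_def] using this
  rw [trace_eq_sum_roots_charpoly, hchar, roots_multiset_prod_X_sub_C]

theorem esymm_mem_of_sum_pow_mem [CharZero L] {s : Multiset L} {F : Subfield L}
    (h : ∀ k : ℕ, (s.map (· ^ k)).sum ∈ F) (k : ℕ) : s.esymm k ∈ F := by
  classical
  induction k using Nat.strong_induction_on with
  | _ k ih =>
    rcases k.eq_zero_or_pos with rfl | hk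
    · simp [Multiset.esymm]
    have hesymm : ∀ j, MvPolynomial.aeval (fun x : s.ToType => (x : L))
        (MvPolynomial.esymm s.ToType L j) = s.esymm j := fun j => by
      rw [MvPolynomial.aeval_esymm_eq_multiset_esymm, Multiset.map_univ_coe]
    have hpsum : ∀ j, MvPolynomial.aeval (fun x : s.ToType => (x : L))
        (MvPolynomial.psum s.ToType L j) = (s.map (· ^ j)).sum := fun j => by
      rw [← Multiset.map_univ]
      simp [MvPolynomial.psum]
    have hnewton := congrArg (MvPolynomial.aeval fun x : s.ToType => (x : L))
      (MvPolynomial.mul_esymm_eq_sum s.ToType L k)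
    simp only [map_mul, map_natCast, map_pow, map_neg, map_one, map_sum, hesymm, hpsum] at hnewton
    have hk' : (k : L) ≠ 0 := Nat.cast_ne_zero.2 hk.ne'
    rw [← mul_div_cancel_left₀ (s.esymm k) hk', hnewton]
    refine div_mem (mul_mem (pow_mem (neg_mem (one_mem _)) _) (sum_mem fun a ha => ?_))
      (natCast_mem _ k)
    exact mul_mem (mul_mem (pow_mem (neg_mem (one_mem _)) _) (ih _ (Finset.mem_filter.1 ha).2))
      (h _)

theorem coeff_charpoly_mem_of_trace_pow_mem [CharZero L] {A : Matrix m m L} {F : Subfield L}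
    (h : ∀ k : ℕ, (A ^ k).trace ∈ F) (j : ℕ) : A.charpoly.coeff j ∈ F := by
  set ι := algebraMap L (AlgebraicClosure L)
  have hroots : (A.charpoly.map ι).coeff j ∈ F.map ι := by
    have : CharZero (AlgebraicClosure L) := charZero_of_injective_algebraMap ι.injective
    rcases lt_or_ge (A.charpoly.map ι).natDegree j with hj | hj
    · rw [coeff_eq_zero_of_natDegree_lt hj]
      exact zero_mem _
    rw [← charpoly_map] at hj ⊢
    rw [coeff_eq_esymm_roots_of_splits (IsAlgClosed.splits _) hj, (charpoly_monic _).leadingCoeff]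
    refine mul_mem (mul_mem (one_mem _) (pow_mem (neg_mem (one_mem _)) _))
      (esymm_mem_of_sum_pow_mem (fun k => ?_) _)
    rw [← trace_pow_eq_sum_roots_charpoly]
    exact ⟨_, h k, by rw [AddMonoidHom.map_trace, Matrix.map_pow]⟩
  rw [coeff_map] at hroots
  rwa [← Subfield.comap_map ι F]

end TracePow

/-! ## The Vinberg field and traces -/

section Cycles

open Matrix

namespace CoxeterPolyhedron

variable {n N : ℕ} (P : CoxeterPolyhedron n N)

theorem prod_one_sub_reflectionMatrix {l : ℕ} (i : Fin (l + 1) → Fin N) :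
    (List.ofFn fun k => 1 - reflectionMatrix (P.normal (i k))).prod =
      (∏ k : Fin l, 2 * P.gram (i k.castSucc) (i k.succ)) •
        (2 : ℝ) • vecMulVec (P.normal (i 0)) (lorentzMatrix n *ᵥ P.normal (i (Fin.last l))) := by
  induction l with
  | zero => simp [reflectionMatrix]
  | succ l ih =>
    rw [List.ofFn_succ, List.prod_cons, ih fun k => i k.succ, Fin.prod_univ_succ, reflectionMatrix,
      sub_sub_cancel, smul_mul_assoc, mul_smul_comm, mul_smul_comm, vecMulVec_mul_vecMulVec,
      ← lorentz_eq_dotProduct]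
    simp only [vecMulVec_smul, smul_smul, Fin.succ_last, Fin.castSucc_zero, Fin.succ_castSucc]
    congr 1
    simp only [gram, of_apply]
    ring

theorem trace_prod_one_sub_reflectionMatrix {l : ℕ} (i : Fin (l + 1) → Fin N) :
    (List.ofFn fun k => 1 - reflectionMatrix (P.normal (i k))).prod.trace = P.cycle i := by
  rw [prod_one_sub_reflectionMatrix, trace_smul, trace_smul, trace_vecMulVec, dotProduct_comm,
    ← lorentz_eq_dotProduct, cycle, Fin.prod_univ_castSucc, Fin.last_add_one]
  simp [gram]

/-- The rational algebra generated by the reflections. The generators `1 - sᵢ` are of rank one, and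
the traces of their products are the cycles. -/
noncomputable def reflectionAlgebra : Subalgebra ℚ (Matrix (Fin (n + 1)) (Fin (n + 1)) ℝ) :=
  Algebra.adjoin ℚ (Set.range fun i => 1 - reflectionMatrix (P.normal i))

theorem trace_mem_vinbergField {A : Matrix (Fin (n + 1)) (Fin (n + 1)) ℝ}
    (hA : A ∈ P.reflectionAlgebra) : A.trace ∈ P.vinbergField := by
  rw [reflectionAlgebra, ← Subalgebra.mem_toSubmodule, Algebra.adjoin_eq_span] at hA
  induction hA using Submodule.span_induction with
  | zero => simp
  | add A B _ _ hA hB => simpa using add_mem hA hB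
  | smul q A _ hA => simpa using P.vinbergField.smul_mem hA
  | mem A hA =>
    obtain ⟨w, hw, rfl⟩ := Submonoid.exists_list_of_mem_closure hA
    obtain ⟨w, rfl⟩ := (Set.range_list_map _).ge hw
    obtain ⟨l, i, rfl⟩ : ∃ l, ∃ i : Fin l → Fin N, w = List.ofFn i := ⟨_, _, (List.ofFn_get w).symm⟩
    rw [List.map_ofFn]
    cases l with
    | zero => simpa using add_mem (natCast_mem P.vinbergField n) (one_mem _)
    | succ l =>
      exact (P.trace_prod_one_sub_reflectionMatrix i).symm ▸
        IntermediateField.subset_adjoin ℚ _ ⟨l, i, rfl⟩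

theorem reflectionMatrix_mem_reflectionAlgebra (i : Fin N) :
    reflectionMatrix (P.normal i) ∈ P.reflectionAlgebra := by
  have hi : 1 - reflectionMatrix (P.normal i) ∈ P.reflectionAlgebra :=
    Algebra.subset_adjoin (Set.mem_range_self i)
  simpa using sub_mem (one_mem _) hi

theorem val_mem_reflectionAlgebra {γ : GL (Fin (n + 1)) ℝ} (hγ : γ ∈ P.coxeterGroup) :
    γ.val ∈ P.reflectionAlgebra := by
  have hle : P.coxeterGroup ≤ P.reflectionAlgebra.toSubmonoid.units := by
    rw [coxeterGroup, Subgroup.closure_le]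
    rintro _ ⟨i, rfl⟩
    exact (Submonoid.mem_units_iff _ _).2
      ⟨P.reflectionMatrix_mem_reflectionAlgebra i, P.reflectionMatrix_mem_reflectionAlgebra i⟩
  exact ((Submonoid.mem_units_iff _ _).1 (hle hγ)).1

theorem coxeterField_le_vinbergField {γ : GL (Fin (n + 1)) ℝ} (hγ : γ ∈ P.coxeterGroup) :
    coxeterField γ ≤ P.vinbergField := by
  refine IntermediateField.adjoin_le_iff.2 ?_
  rintro _ ⟨j, rfl⟩
  exact coeff_charpoly_mem_of_trace_pow_mem (F := P.vinbergField.toSubfield)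
    (fun k => P.trace_mem_vinbergField (pow_mem (P.val_mem_reflectionAlgebra hγ) k)) j

end CoxeterPolyhedron

end Cycles

/-! ## The normal vectors of a polyhedron of finite volume span -/

section Volume

open Filter Matrix MeasureTheory Topology

variable {n N : ℕ}

theorem continuous_lorentz : Continuous fun p : (Fin (n + 1) → ℝ) × (Fin (n + 1) → ℝ) =>
    lorentz p.1 p.2 := by
  unfold lorentz
  fun_prop

theorem lorentz_add_left (x y w : Fin (n + 1) → ℝ) :
    lorentz (x + y) w = lorentz x w + lorentz y w := by
  simp only [lorentz_eq_dotProduct, mulVec_add, add_dotProduct]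

theorem lorentz_smul_left (a : ℝ) (x w : Fin (n + 1) → ℝ) :
    lorentz (a • x) w = a * lorentz x w := by
  simp only [lorentz_eq_dotProduct, mulVec_smul, smul_dotProduct, smul_eq_mul]

theorem lorentz_self_nonneg_of_sq_le {x : Fin (n + 1) → ℝ} (j : Fin n)
    (hj : x (Fin.last n) ^ 2 ≤ x j.castSucc ^ 2) : 0 ≤ lorentz x x := by
  simp only [lorentz, ← sq]
  exact sub_nonneg.2 (hj.trans (Finset.single_le_sum (f := fun i : Fin n => x i.castSucc ^ 2)
    (fun i _ => sq_nonneg _) (Finset.mem_univ j)))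

theorem hyperboloidPoint_castSucc (x : Fin n → ℝ) (i : Fin n) :
    hyperboloidPoint x i.castSucc = x i := by
  simp [hyperboloidPoint]

theorem hyperboloidPoint_last (x : Fin n → ℝ) :
    hyperboloidPoint x (Fin.last n) = √(1 + ∑ i, x i ^ 2) := by
  simp [hyperboloidPoint]

theorem hyperboloidPoint_mem (x : Fin n → ℝ) : hyperboloidPoint x ∈ hyperbolicSpace n := by
  have hpos : 0 < 1 + ∑ i, x i ^ 2 :=
    add_pos_of_pos_of_nonneg one_pos (Finset.sum_nonneg fun _ _ => sq_nonneg _)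
  refine ⟨?_, by simpa [hyperboloidPoint_last] using hpos⟩
  simp [lorentz, hyperboloidPoint_castSucc, hyperboloidPoint_last, Real.mul_self_sqrt hpos.le, ← sq]

theorem tendsto_inv_smul_hyperboloidPoint_smul {z : Fin (n + 1) → ℝ} (hz : lorentz z z = 0)
    (hlast : 0 ≤ z (Fin.last n)) :
    Tendsto (fun p : (Fin n → ℝ) × ℝ => p.2⁻¹ • hyperboloidPoint (p.2 • p.1))
      (𝓝 (fun i => z i.castSucc) ×ˢ atTop) (𝓝 z) := by
  have hpos : ∀ᶠ p : (Fin n → ℝ) × ℝ in 𝓝 (fun i => z i.castSucc) ×ˢ atTop, 0 < p.2 :=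
    tendsto_snd.eventually (eventually_gt_atTop 0)
  refine tendsto_pi_nhds.2 fun i => ?_
  refine Fin.lastCases ?_ (fun i => ?_) i
  · have hlim : Tendsto (fun p : (Fin n → ℝ) × ℝ => √(p.2⁻¹ ^ 2 + ∑ i, p.1 i ^ 2))
        (𝓝 (fun i => z i.castSucc) ×ˢ atTop) (𝓝 √(0 ^ 2 + ∑ i : Fin n, z i.castSucc ^ 2)) := by
      refine (((tendsto_inv_atTop_zero.comp tendsto_snd).pow 2).add
        (tendsto_finsetSum _ fun i _ => ?_)).sqrt
      exact (((continuous_apply i).tendsto _).comp tendsto_fst).pow 2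
    have hsum : ∑ i : Fin n, z i.castSucc ^ 2 = z (Fin.last n) ^ 2 := by
      simpa only [lorentz, ← sq, sub_eq_zero] using hz
    rw [hsum, zero_pow two_ne_zero, zero_add, Real.sqrt_sq hlast] at hlim
    refine hlim.congr' (hpos.mono fun p hp => ?_)
    simp only [Pi.smul_apply, hyperboloidPoint_last, smul_eq_mul, mul_pow, ← Finset.mul_sum]
    rw [← Real.sqrt_sq (inv_pos.2 hp).le, ← Real.sqrt_mul (sq_nonneg _), mul_add, ← mul_assoc,
      Real.sqrt_sq (inv_pos.2 hp).le, ← mul_pow, inv_mul_cancel₀ hp.ne', one_pow, one_mul, mul_one]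
  · refine (((continuous_apply i).tendsto _).comp tendsto_fst).congr' (hpos.mono fun p hp => ?_)
    simp [hyperboloidPoint_castSucc, hp.ne']

theorem ofReal_one_div_mul_volume_le_hyperbolicVolume {A : Set (Fin (n + 1) → ℝ)}
    {B : Set (Fin n → ℝ)} (hB : MeasurableSet B) {b : ℝ}
    (hA : ∀ x ∈ B, hyperboloidPoint x ∈ A)
    (hb : ∀ x ∈ B, hyperboloidPoint x (Fin.last n) ≤ b) :
    ENNReal.ofReal (1 / b) * volume B ≤ hyperbolicVolume A :=
  calc ENNReal.ofReal (1 / b) * volume B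
      = ∫⁻ _ in B, ENNReal.ofReal (1 / b) := (setLIntegral_const _ _).symm
    _ ≤ ∫⁻ x in B, ENNReal.ofReal (1 / √(1 + ∑ i, x i ^ 2)) := by
        refine setLIntegral_mono' hB fun x hx => ENNReal.ofReal_le_ofReal ?_
        rw [← hyperboloidPoint_last]
        exact one_div_le_one_div_of_le (hyperboloidPoint_mem x).2 (hb x hx)
    _ ≤ hyperbolicVolume A := lintegral_mono_set hA

theorem ofReal_mul_le_hyperbolicVolume_of_ball (hn : 2 ≤ n) {A : Set (Fin (n + 1) → ℝ)}
    {c : Fin n → ℝ} {δ b r : ℝ} (hδ : 0 < δ) (hb : 0 < b) (hr : 1 ≤ r)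
    (hA : ∀ x ∈ Metric.ball (r • c) (r * δ), hyperboloidPoint x ∈ A)
    (hlast : ∀ x ∈ Metric.ball (r • c) (r * δ), hyperboloidPoint x (Fin.last n) ≤ r * b) :
    ENNReal.ofReal ((2 * δ) ^ n / b * r) ≤ hyperbolicVolume A := by
  have hr0 : 0 < r := one_pos.trans_le hr
  have hpow : r ≤ r ^ n / r := by
    rw [le_div_iff₀ hr0, ← sq]
    exact pow_le_pow_right₀ hr hn
  calc ENNReal.ofReal ((2 * δ) ^ n / b * r)
      ≤ ENNReal.ofReal ((2 * δ) ^ n / b * (r ^ n / r)) := by gcongr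
    _ = ENNReal.ofReal (1 / (r * b)) * volume (Metric.ball (r • c) (r * δ)) := by
        rw [Real.volume_pi_ball _ (by positivity), ← ENNReal.ofReal_mul (by positivity),
          Fintype.card_fin, mul_left_comm 2 r δ, mul_pow r]
        congr 1
        field_simp
    _ ≤ hyperbolicVolume A :=
        ofReal_one_div_mul_volume_le_hyperbolicVolume measurableSet_ball hA hlast

theorem hyperbolicVolume_eq_top_of_isOpen_cone (hn : 2 ≤ n) {U : Set (Fin (n + 1) → ℝ)}
    (hU : IsOpen U) (hcone : ∀ r : ℝ, 0 < r → ∀ y ∈ U, r • y ∈ U) {z : Fin (n + 1) → ℝ}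
    (hz : lorentz z z = 0) (hlast : 0 ≤ z (Fin.last n)) (hzU : z ∈ U)
    {A : Set (Fin (n + 1) → ℝ)} (hA : U ∩ hyperbolicSpace n ⊆ A) : hyperbolicVolume A = ⊤ := by
  set b := z (Fin.last n) + 1
  have hb : 0 < b := by positivity
  have hev : ∀ᶠ y in 𝓝 z, y ∈ U ∧ y (Fin.last n) < b :=
    (hU.eventually_mem hzU).and
      ((continuous_apply (Fin.last n)).continuousAt.eventually (gt_mem_nhds (lt_add_one _)))
  obtain ⟨B, hB, I, hI, hBI⟩ := eventually_prod_iff.1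
    ((tendsto_inv_smul_hyperboloidPoint_smul hz hlast).eventually hev)
  obtain ⟨δ, hδ, hball⟩ := Metric.eventually_nhds_iff_ball.1 hB
  set z' : Fin n → ℝ := fun i => z i.castSucc
  have hlow : ∀ᶠ r : ℝ in atTop, ENNReal.ofReal ((2 * δ) ^ n / b * r) ≤ hyperbolicVolume A := by
    filter_upwards [hI, eventually_ge_atTop 1] with r hr hr1
    have hr0 : 0 < r := one_pos.trans_le hr1
    have hmem : ∀ x ∈ Metric.ball (r • z') (r * δ), r⁻¹ • hyperboloidPoint x ∈ U ∧
        (r⁻¹ • hyperboloidPoint x) (Fin.last n) < b := fun x hx => by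
      have hx' : r⁻¹ • x ∈ Metric.ball z' δ := by
        rwa [← smul_inv_smul₀ hr0.ne' x, Metric.mem_ball, dist_smul₀, Real.norm_of_nonneg hr0.le,
          mul_lt_mul_iff_right₀ hr0] at hx
      simpa only [smul_inv_smul₀ hr0.ne'] using hBI (hball _ hx') hr
    refine ofReal_mul_le_hyperbolicVolume_of_ball hn hδ hb hr1
      (fun x hx => hA ⟨?_, hyperboloidPoint_mem x⟩)
      fun x hx => (inv_mul_le_iff₀ hr0).1 (hmem x hx).2.le
    rw [← smul_inv_smul₀ hr0.ne' (hyperboloidPoint x)]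
    exact hcone r hr0 _ (hmem x hx).1
  refine top_le_iff.1 (le_of_tendsto ?_ hlow)
  exact ENNReal.tendsto_ofReal_atTop.comp (tendsto_id.const_mul_atTop (by positivity))

theorem exists_null_add_smul {x v : Fin (n + 1) → ℝ} (hx : x ∈ hyperbolicSpace n) (hv : v ≠ 0) :
    ∃ t : ℝ, lorentz (x + t • v) (x + t • v) = 0 ∧ 0 ≤ (x + t • v) (Fin.last n) := by
  obtain ⟨t, hspace, hlast⟩ : ∃ t : ℝ,
      0 ≤ lorentz (x + t • v) (x + t • v) ∧ 0 ≤ (x + t • v) (Fin.last n) := by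
    by_cases hvlast : v (Fin.last n) = 0
    · obtain ⟨j, hj⟩ : ∃ j : Fin n, v j.castSucc ≠ 0 := by
        by_contra! h
        exact hv (funext (Fin.lastCases hvlast h))
      refine ⟨(x (Fin.last n) - x j.castSucc) / v j.castSucc,
        lorentz_self_nonneg_of_sq_le j ?_, ?_⟩
      · simp [hvlast, div_mul_cancel₀ _ hj]
      · simpa [hvlast] using hx.2.le
    · have hzero : (x + (-x (Fin.last n) / v (Fin.last n)) • v) (Fin.last n) = 0 := by
        simp [div_mul_cancel₀ _ hvlast]
      refine ⟨-x (Fin.last n) / v (Fin.last n), ?_, hzero.ge⟩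
      rw [lorentz, hzero, mul_zero, sub_zero]
      exact Finset.sum_nonneg fun i _ => mul_self_nonneg _
  have hcont : Continuous fun s : ℝ => lorentz (x + s • t • v) (x + s • t • v) :=
    continuous_lorentz.comp
      (show Continuous fun s : ℝ => (x + s • t • v, x + s • t • v) by fun_prop)
  obtain ⟨s, ⟨hs0, hs1⟩, hs⟩ := intermediate_value_Icc zero_le_one hcont.continuousOn
    (show (0 : ℝ) ∈ _ from ⟨by simp [hx.1], by simpa using hspace⟩)
  refine ⟨s * t, by rwa [mul_smul], ?_⟩
  calc 0 ≤ (1 - s) * x (Fin.last n) + s * (x + t • v) (Fin.last n) :=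
        add_nonneg (mul_nonneg (sub_nonneg.2 hs1) hx.2.le) (mul_nonneg hs0 hlast)
    _ = (x + (s * t) • v) (Fin.last n) := by
        simp only [Pi.add_apply, Pi.smul_apply, smul_eq_mul]
        ring

theorem lorentzMatrix_mul_self : lorentzMatrix n * lorentzMatrix n = 1 := by
  rw [lorentzMatrix, diagonal_mul_diagonal, ← diagonal_one]
  congr 1
  ext i
  split <;> simp

namespace CoxeterPolyhedron

variable (P : CoxeterPolyhedron n N)

theorem hyperbolicVolume_carrier_eq_top (hn : 2 ≤ n) {z : Fin (n + 1) → ℝ}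
    (hz : lorentz z z = 0) (hlast : 0 ≤ z (Fin.last n)) (hneg : ∀ i, lorentz z (P.normal i) < 0) :
    hyperbolicVolume P.carrier = ⊤ := by
  refine hyperbolicVolume_eq_top_of_isOpen_cone hn
    (U := {y | ∀ i, lorentz y (P.normal i) < 0}) ?_ (fun r hr y hy i => ?_) hz hlast hneg
    fun y hy => ⟨hy.2, fun i => (hy.1 i).le⟩
  · simp only [Set.ofPred_forall]
    exact isOpen_iInter_of_finite fun i => isOpen_lt
      (continuous_lorentz.comp (.prodMk_left (P.normal i))) continuous_const
  · rw [lorentz_smul_left]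
    exact mul_neg_of_pos_of_neg hr (hy i)

theorem eq_zero_of_forall_lorentz_eq_zero (hn : 2 ≤ n) (hP : P.IsCofinite) {v : Fin (n + 1) → ℝ}
    (hv : ∀ i, lorentz v (P.normal i) = 0) : v = 0 := by
  by_contra hv0
  obtain ⟨x, hx, hxneg⟩ := P.interior_nonempty
  obtain ⟨t, hnull, hlast⟩ := exists_null_add_smul hx hv0
  refine hP.ne (P.hyperbolicVolume_carrier_eq_top hn hnull hlast fun i => ?_)
  rw [lorentz_add_left, lorentz_smul_left, hv, mul_zero, add_zero]
  exact hxneg i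

theorem gram_eq_mul_lorentzMatrix_mul_transpose :
    P.gram = of P.normal * lorentzMatrix n * (of P.normal)ᵀ := by
  ext i j
  rw [Matrix.mul_assoc]
  change lorentz (P.normal i) (P.normal j) = P.normal i ⬝ᵥ (lorentzMatrix n *ᵥ P.normal j)
  rw [lorentz_comm, lorentz_eq_dotProduct, dotProduct_comm]

theorem exists_mul_normal_eq_one (hn : 2 ≤ n) (hP : P.IsCofinite) :
    ∃ B : Matrix (Fin (n + 1)) (Fin N) ℝ, B * of P.normal = 1 := by
  have hinj : LinearMap.ker (toLin' (of P.normal)) = ⊥ := by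
    refine LinearMap.ker_eq_bot'.2 fun u hu => ?_
    have hJ : lorentzMatrix n *ᵥ lorentzMatrix n *ᵥ u = u := by
      rw [mulVec_mulVec, lorentzMatrix_mul_self, one_mulVec]
    rw [← hJ, P.eq_zero_of_forall_lorentz_eq_zero hn hP (v := lorentzMatrix n *ᵥ u), mulVec_zero]
    intro i
    rw [lorentz_eq_dotProduct, hJ, dotProduct_comm]
    exact congrFun hu i
  obtain ⟨g, hg⟩ := LinearMap.exists_leftInverse_of_injective _ hinj
  refine ⟨LinearMap.toMatrix' g, ?_⟩
  simpa [LinearMap.toMatrix'_comp] using congrArg LinearMap.toMatrix' hg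

theorem not_posSemidef_gram (hn : 2 ≤ n) (hP : P.IsCofinite) : ¬P.gram.PosSemidef := by
  intro hG
  obtain ⟨B, hB⟩ := P.exists_mul_normal_eq_one hn hP
  have hJ : B * P.gram * Bᵀ = lorentzMatrix n :=
    calc B * P.gram * Bᵀ = (B * of P.normal) * lorentzMatrix n * (B * of P.normal)ᵀ := by
          rw [gram_eq_mul_lorentzMatrix_mul_transpose, transpose_mul]
          simp only [Matrix.mul_assoc]
      _ = lorentzMatrix n := by rw [hB]; simp
  have hlast := (hG.mul_mul_conjTranspose_same B).diag_nonneg (i := Fin.last n)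
  rw [conjTranspose_eq_transpose_of_trivial, hJ] at hlast
  norm_num [lorentzMatrix] at hlast

end CoxeterPolyhedron

end Volume

/-! ## The field of definition of a quasi-arithmetic group -/

section FieldOfDefinition

open Matrix

theorem le_of_forall_embedding_eq (F L : IntermediateField ℚ ℝ) [NumberField F]
    [NumberField.IsTotallyReal F]
    (h : ∀ σ : F →+* ℝ, (∀ x : F, (x : ℝ) ∈ L → σ x = x) → σ = algebraMap F ℝ) : F ≤ L := by
  let E : IntermediateField ℚ F := L.comap F.val
  let ψ : F →+* ℂ := Complex.ofRealHom.comp (algebraMap F ℝ)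
  let _ : Algebra E ℂ := (ψ.comp (algebraMap E F)).toAlgebra
  have eq_inclusion : ∀ φ : F →ₐ[E] ℂ, φ.toRingHom = ψ := by
    intro φ
    have hreal := NumberField.IsTotallyReal.complexEmbedding_isReal φ.toRingHom
    have hσ := h hreal.embedding fun x hx => by
      apply Complex.ofReal_injective
      rw [hreal.coe_embedding_apply]
      exact φ.commutes ⟨x, hx⟩
    ext x
    rw [← hreal.coe_embedding_apply, hσ]
    rfl
  have hfinrank : Module.finrank E F ≤ 1 := by
    rw [← AlgHom.card E F ℂ, Fintype.card_le_one_iff]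
    intro φ φ'
    ext x
    exact RingHom.congr_fun ((eq_inclusion φ).trans (eq_inclusion φ').symm) x
  have hE : E = ⊤ := IntermediateField.finrank_eq_one_iff_eq_top.1
    (le_antisymm hfinrank Module.finrank_pos)
  intro x hx
  exact (hE ▸ IntermediateField.mem_top : (⟨x, hx⟩ : F) ∈ E)

section Matrix

variable {m : Type*} [Fintype m] [DecidableEq m]

theorem abs_eq_one_of_isRoot_charpoly_of_posDef {Q A : Matrix m m ℝ} (hQ : Q.PosDef)
    (hA : Aᵀ * Q * A = Q) {r : ℝ} (hr : A.charpoly.IsRoot r) : |r| = 1 := by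
  rw [← charpoly_toLin', ← Module.End.hasEigenvalue_iff_isRoot_charpoly] at hr
  obtain ⟨v, hv⟩ := hr.exists_hasEigenvector
  have hAv : A *ᵥ v = r • v := hv.apply_eq_smul
  have hpos : 0 < v ⬝ᵥ (Q *ᵥ v) := by simpa using hQ.dotProduct_mulVec_pos hv.2
  have hform : v ⬝ᵥ (Q *ᵥ v) = r * r * (v ⬝ᵥ (Q *ᵥ v)) := by
    conv_lhs => rw [← hA, ← mulVec_mulVec, ← mulVec_mulVec, hAv,
      dotProduct_mulVec, vecMul_transpose, hAv, mulVec_smul, smul_dotProduct, dotProduct_smul,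
      smul_eq_mul, smul_eq_mul, ← mul_assoc]
  rw [← sq_eq_sq₀ (abs_nonneg r) zero_le_one, sq_abs, sq, one_pow]
  exact (mul_eq_right₀ hpos.ne').1 hform.symm

variable {K L : Type*} [CommRing K] [CommRing L] (f : K →+* L) (S : GL m L)

/-- Base change along `f` followed by conjugation with `S`: the homomorphism `B ↦ S f(B) S⁻¹`. -/
noncomputable def conjMapMatrix : Matrix m m K →+* Matrix m m L :=
  (MulSemiringAction.toRingHom (ConjAct (GL m L)) (Matrix m m L) (ConjAct.toConjAct S)).comp
    f.mapMatrix

theorem conjMapMatrix_apply (B : Matrix m m K) :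
    conjMapMatrix f S B = S.val * B.map f * S⁻¹.val := rfl

theorem trace_conjMapMatrix (B : Matrix m m K) : (conjMapMatrix f S B).trace = f B.trace := by
  rw [conjMapMatrix_apply, trace_units_conj, AddMonoidHom.map_trace]

theorem charpoly_conjMapMatrix (B : Matrix m m K) :
    (conjMapMatrix f S B).charpoly = B.charpoly.map f := by
  rw [conjMapMatrix_apply, coe_units_inv, charpoly_units_conj, charpoly_map]

theorem conjMapMatrix_eq_of_map_eq {γ : GL m L} {A : Matrix m m K}
    (hA : A.map f = (S⁻¹ * γ * S).val) : conjMapMatrix f S A = γ.val := by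
  rw [conjMapMatrix_apply, hA, ← Units.val_mul, ← Units.val_mul]
  group

end Matrix

variable {n N : ℕ}

theorem charpoly_map_eq_of_forall_mem_coxeterField {F : IntermediateField ℚ ℝ}
    {γ : GL (Fin (n + 1)) ℝ} {p : Polynomial F}
    (hp : p.map (algebraMap F ℝ) = γ.val.charpoly) {σ : F →+* ℝ}
    (hσ : ∀ x : F, (x : ℝ) ∈ coxeterField γ → σ x = x) : p.map σ = γ.val.charpoly := by
  rw [← hp]
  ext j
  rw [Polynomial.coeff_map, Polynomial.coeff_map]
  refine hσ _ (IntermediateField.subset_adjoin ℚ _ ⟨j, ?_⟩)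
  simp only [← hp, Polynomial.coeff_map]
  rfl

theorem IsQuasiArithmetic.exists_isometry {Γ : Subgroup (GL (Fin (n + 1)) ℝ)}
    (hΓ : IsQuasiArithmetic Γ) :
    ∃ (F : IntermediateField ℚ ℝ) (Q : Matrix (Fin (n + 1)) (Fin (n + 1)) F)
      (S : GL (Fin (n + 1)) ℝ), NumberField F ∧ NumberField.IsTotallyReal F ∧
      (∀ σ : F →+* ℝ, σ ≠ algebraMap F ℝ → (Q.map σ).PosDef) ∧
      ∀ γ ∈ Γ, ∃ A : Matrix (Fin (n + 1)) (Fin (n + 1)) F,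
        Aᵀ * Q * A = Q ∧ conjMapMatrix (algebraMap F ℝ) S A = γ.val := by
  obtain ⟨F, Q, S, hF, hreal, -, -, hpos, -, hdef⟩ := hΓ
  refine ⟨F, Q, S, hF, hreal, hpos, fun γ hγ => ?_⟩
  obtain ⟨⟨hpres, -⟩, A, hA⟩ := hdef γ hγ
  have hA' : A.val.map (algebraMap F ℝ) = (S⁻¹ * γ * S).val := congrArg Units.val hA
  refine ⟨A.val, map_injective (algebraMap F ℝ).injective ?_, conjMapMatrix_eq_of_map_eq _ S hA'⟩
  simpa only [Matrix.map_mul, transpose_map, hA'] using hpres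

theorem le_coxeterField {F : IntermediateField ℚ ℝ} [NumberField F] [NumberField.IsTotallyReal F]
    {Q A : Matrix (Fin (n + 1)) (Fin (n + 1)) F} {S γ : GL (Fin (n + 1)) ℝ}
    (hQ : ∀ σ : F →+* ℝ, σ ≠ algebraMap F ℝ → (Q.map σ).PosDef) (hAQ : Aᵀ * Q * A = Q)
    (hA : conjMapMatrix (algebraMap F ℝ) S A = γ.val) {r : ℝ} (hr : |r| ≠ 1)
    (hroot : γ.val.charpoly.IsRoot r) : F ≤ coxeterField γ := by
  refine le_of_forall_embedding_eq F _ fun σ hσ => ?_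
  by_contra hne
  have hcharpoly : (A.map σ).charpoly = γ.val.charpoly := by
    rw [charpoly_map]
    exact charpoly_map_eq_of_forall_mem_coxeterField (by rw [← hA, charpoly_conjMapMatrix]) hσ
  refine hr (abs_eq_one_of_isRoot_charpoly_of_posDef (hQ σ hne) ?_ (hcharpoly ▸ hroot))
  simpa only [Matrix.map_mul, ← transpose_map] using congrArg (fun M => M.map σ) hAQ

namespace CoxeterPolyhedron

variable (P : CoxeterPolyhedron n N)

theorem vinbergField_le {F : IntermediateField ℚ ℝ} {S : GL (Fin (n + 1)) ℝ}
    (hS : ∀ i, reflectionMatrix (P.normal i) ∈ (conjMapMatrix (algebraMap F ℝ) S).range) :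
    P.vinbergField ≤ F := by
  refine IntermediateField.adjoin_le_iff.2 ?_
  rintro _ ⟨l, i, rfl⟩
  obtain ⟨B, hB⟩ : (List.ofFn fun k => 1 - reflectionMatrix (P.normal (i k))).prod ∈
      (conjMapMatrix (algebraMap F ℝ) S).range := by
    refine list_prod_mem fun M hM => ?_
    obtain ⟨k, rfl⟩ := (List.mem_ofFn' _ _).1 hM
    exact sub_mem (one_mem _) (hS (i k))
  rw [← P.trace_prod_one_sub_reflectionMatrix i, ← hB, trace_conjMapMatrix]
  exact B.trace.2

theorem vinbergField_eq_coxeterField (hqa : IsQuasiArithmetic P.coxeterGroup)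
    {γ : GL (Fin (n + 1)) ℝ} (hγ : γ ∈ P.coxeterGroup) {r : ℝ} (hr : |r| ≠ 1)
    (hroot : γ.val.charpoly.IsRoot r) : P.vinbergField = coxeterField γ := by
  refine le_antisymm ?_ (P.coxeterField_le_vinbergField hγ)
  obtain ⟨F, Q, S, _, _, hQ, hdef⟩ := hqa.exists_isometry
  obtain ⟨A, hAQ, hA⟩ := hdef γ hγ
  refine (P.vinbergField_le (S := S) fun i => ?_).trans (le_coxeterField hQ hAQ hA hr hroot)
  obtain ⟨B, -, hB⟩ := hdef (P.reflection i) (Subgroup.subset_closure ⟨i, rfl⟩)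
  exact ⟨B, hB⟩

end CoxeterPolyhedron

end FieldOfDefinition

theorem mainTheorem4_general {n N : ℕ} (P : CoxeterPolyhedron n N) (hG : ¬P.gram.PosSemidef)
    (hqa : IsQuasiArithmetic P.coxeterGroup) (π : Equiv.Perm (Fin N)) :
    P.vinbergField = coxeterField (P.coxeterTransformation π) := by
  obtain ⟨r, hr, hroot⟩ := P.exists_one_lt_isRoot_charpoly_coxeterTransformation π hG
  exact P.vinbergField_eq_coxeterField hqa (P.coxeterTransformation_mem π)
    (hr.trans_le (le_abs_self r)).ne' hroot

theorem mainTheorem4 (n N : ℕ) (hn : 2 ≤ n) (P : CoxeterPolyhedron n N)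
    (hcof : P.IsCofinite) (hqa : IsQuasiArithmetic P.coxeterGroup)
    (π : Equiv.Perm (Fin N)) :
    P.vinbergField = coxeterField (P.coxeterTransformation π) :=
  mainTheorem4_general P (P.not_posSemidef_gram hn hcof) hqa π
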